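/- Let $q=e^{2\pi i/3}$ and $n\ge 0$. Consider the six-vertex model on the $n\times n$ square grid with domain wall boundary conditions: every edge carries an arrow, each vertex has two incoming and two outgoing arrows, all external arrows at the left and right point in, and all those at the top and bottom point out. The rows (from top to bottom) carry nonzero complex parameters $z_1,\dots,z_n$ and the columns (from left to right) carry nonzero complex parameters $z_{n+1},\dots,z_{2n}$. A vertex in a row with parameter $z$ and a column with parameter $w$ has weight $$a=q^{-1/2}w-q^{1/2}z,\qquad b=q^{-1/2}z-q^{1/2}w,\qquad c=(q^{-1}-q)\,z^{1/2}w^{1/2},$$ where $a$ is used if its arrows are $(\rightarrow,\uparrow)$ or $(\leftarrow,\downarrow)$, $b$ if they are $(\rightarrow,\downarrow)$ or $(\leftarrow,\uparrow)$ (both horizontal edges, respectively both vertical edges, having the given direction), and $c$ if the two horizontal arrows are opposite to each other. Let $\tilde Z_n$ be the sum over all configurations of the product of the vertex weights, and $$Z_n=(-1)^{n(n-1)/2}(q^{-1}-q)^{-n}\prod_{i=1}^{2n}z_i^{-1/2}\ \tilde Z_n .$$ Then, for every choice of the square roots $q^{1/2}$ and $z_i^{1/2}$, $Z_n$ is given by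 one and the same polynomial in $z_1,\dots,z_{2n}$, also denoted $Z_n$, and it is the Schur function of the Young diagram $Y_n$ with two rows of each of the lengths $n-1,n-2,\dots,2,1$: $$Z_n(z_1,\dots,z_{2n})=s_{Y_n}(z_1,\dots,z_{2n})=\frac{\det\big[z_i^{2n-j+d_j}\big]_{1\le i,j\le 2n}}{\det\big[z_i^{2n-j}\big]_{1\le i,j\le 2n}},\qquad (d_j)=(n-1,n-1,n-2,n-2,\dots,1,1,0,0).$$ Consequently $Z_n$ is symmetric in all the variables $z_1,\dots,z_{2n}$; it has degree $n-1$ in each variable; and for $n\ge 1$ and all $i\ne j$ in $\{1,\dots,2n\}$, $$Z_n(z_1,\dots,z_j=q^2z_i,\dots,z_{2n})=\prod_{k\ne i,j}(q z_i-z_k)\ Z_{n-1}(z_1,\dots,\hat z_i,\dots,\hat z_j,\dots,z_{2n}),$$ where $Z_0=1$ and hats denote omitted variables. -/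

import Mathlib

noncomputable section

/-- A choice of arrows on all the edges of the `n × n` square grid (external edges included).
The first component gives the horizontal edges: in row `i` (counted from the top) these are the
edges `0, …, n` from left to right, and `true` means that the arrow points to the right.
The second component gives the vertical edges: in column `j` (counted from the left) these are
the edges `0, …, n` from top to bottom, and `true` means that the arrow points up. -/
abbrev ArrowConfig (n : ℕ) : Type :=
  (Fin n → Fin (n + 1) → Bool) × (Fin (n + 1) → Fin n → Bool)

namespace ArrowConfig

variable {n : ℕ}

/-- The arrow on the edge to the left of the vertex `(i, j)` (`true`: pointing right). -/
def left (C : ArrowConfig n) (i j : Fin n) : Bool := C.1 i j.castSucc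

/-- The arrow on the edge to the right of the vertex `(i, j)` (`true`: pointing right). -/
def right (C : ArrowConfig n) (i j : Fin n) : Bool := C.1 i j.succ

/-- The arrow on the edge above the vertex `(i, j)` (`true`: pointing up). -/
def above (C : ArrowConfig n) (i j : Fin n) : Bool := C.2 i.castSucc j

/-- The arrow on the edge below the vertex `(i, j)` (`true`: pointing up). -/
def below (C : ArrowConfig n) (i j : Fin n) : Bool := C.2 i.succ j

/-- The number of arrows that point into the vertex `(i, j)`. -/
def inDegree (C : ArrowConfig n) (i j : Fin n) : ℕ :=
  (if C.left i j = true then 1 else 0) + (if C.right i j = false then 1 else 0) +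
    (if C.above i j = false then 1 else 0) + (if C.below i j = true then 1 else 0)

/-- The six-vertex configurations with domain wall boundary conditions: two arrows in and two
arrows out at each vertex, all arrows at the left and at the right boundary pointing in, and all
arrows at the top and at the bottom boundary pointing out. -/
def IsDWBC (C : ArrowConfig n) : Prop :=
  (∀ i j, C.inDegree i j = 2) ∧
    (∀ i, C.1 i 0 = true) ∧ (∀ i, C.1 i (Fin.last n) = false) ∧
    (∀ j, C.2 0 j = true) ∧ (∀ j, C.2 (Fin.last n) j = false)

end ArrowConfig

/-- The weight of a vertex. Here `p` is `q^{1/2}`, while `x` is `z^{1/2}` and `y` is `w^{1/2}` for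
the parameter `z` of the row and the parameter `w` of the column. The weights are
`a = q^{-1/2} w - q^{1/2} z`, `b = q^{-1/2} z - q^{1/2} w`, `c = (q^{-1} - q) z^{1/2} w^{1/2}`.
The arguments `l r t d` are the arrows on the left, right, upper and lower edge
(`true`: pointing right, respectively up). -/
def vertexWeight (p x y : ℂ) (l r t d : Bool) : ℂ :=
  match l, r, t, d with
  | true, true, true, true => p⁻¹ * y ^ 2 - p * x ^ 2
  | false, false, false, false => p⁻¹ * y ^ 2 - p * x ^ 2
  | true, true, false, false => p⁻¹ * x ^ 2 - p * y ^ 2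
  | false, false, true, true => p⁻¹ * x ^ 2 - p * y ^ 2
  | true, false, true, false => ((p ^ 2)⁻¹ - p ^ 2) * x * y
  | false, true, false, true => ((p ^ 2)⁻¹ - p ^ 2) * x * y
  | _, _, _, _ => 0

/-- The index of the parameter of row `i`: the rows carry the first `n` parameters. -/
def rowIndex {n : ℕ} (i : Fin n) : Fin (2 * n) := ⟨i, by omega⟩

/-- The index of the parameter of column `j`: the columns carry the last `n` parameters. -/
def colIndex {n : ℕ} (j : Fin n) : Fin (2 * n) := ⟨n + j, by omega⟩

open Classical in
/-- The six-vertex partition function with domain wall boundary conditions, with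
`q = p ^ 2` and spectral parameters `z_k = x_k ^ 2`. -/
def partitionFunction (n : ℕ) (p : ℂ) (x : Fin (2 * n) → ℂ) : ℂ :=
  ∑ C : ArrowConfig n with C.IsDWBC, ∏ i : Fin n, ∏ j : Fin n,
    vertexWeight p (x (rowIndex i)) (x (colIndex j))
      (C.left i j) (C.right i j) (C.above i j) (C.below i j)

/-- The normalized partition function: the partition function divided by
`(-1)^{n(n-1)/2} (q^{-1} - q)^n ∏ z_k^{1/2}`, with `q = p ^ 2` and `z_k = x_k ^ 2`. -/
def normalizedPartitionFunction (n : ℕ) (p : ℂ) (x : Fin (2 * n) → ℂ) : ℂ :=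
  partitionFunction n p x /
    ((-1) ^ (n * (n - 1) / 2) * ((p ^ 2)⁻¹ - p ^ 2) ^ n * ∏ k, x k)

/-- The alternant `det (z_i ^ (e j))` in the variables `z_i`, `i : Fin N`. -/
def alternant (N : ℕ) (e : Fin N → ℕ) : MvPolynomial (Fin N) ℂ :=
  Matrix.det (Matrix.of fun i j : Fin N => (MvPolynomial.X i : MvPolynomial (Fin N) ℂ) ^ e j)

/-- The Schur function `s_Y(z_1, …, z_N)` of a Young diagram `Y` with at most `N` rows, as the
quotient of alternants `det (z_i ^ (N - j + Y_j)) / det (z_i ^ (N - j))`, `1 ≤ j ≤ N`, where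
`Y_j` is the length of the `j`-th row (in the code `j` counts from `0`). The denominator is a
Vandermonde determinant, a nonzero polynomial. -/
def schurFunction (N : ℕ) (Y : YoungDiagram) : FractionRing (MvPolynomial (Fin N) ℂ) :=
  algebraMap _ _ (alternant N fun j => N - 1 - j + Y.rowLen j) /
    algebraMap _ _ (alternant N fun j => N - 1 - j)

/-- The Young diagram with two rows of each of the lengths `n - 1, n - 2, …, 2, 1`. -/
def doubleStaircase (n : ℕ) : YoungDiagram :=
  YoungDiagram.ofRowLens (List.ofFn fun i : Fin (2 * (n - 1)) => n - 1 - (i : ℕ) / 2) (by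
    rw [List.sortedGE_ofFn_iff]
    intro i j hij
    have : (i : ℕ) ≤ j := hij
    dsimp only
    omega)

/-- The indices other than `i` and `j`. -/
def othersOf {m : ℕ} (i j : Fin m) : Finset (Fin m) := (Finset.univ.erase i).erase j

theorem card_othersOf {n : ℕ} {i j : Fin (2 * (n + 1))} (h : i ≠ j) :
    (othersOf i j).card = 2 * n := by
  rw [othersOf, Finset.card_erase_of_mem (by simp [h.symm]), Finset.card_erase_of_mem (by simp)]
  simp
  omega

/-- The list `z` with the entries `z_i` and `z_j` left out, in the same order. -/
def omitTwo {n : ℕ} {i j : Fin (2 * (n + 1))} (h : i ≠ j) (z : Fin (2 * (n + 1)) → ℂ) :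
    Fin (2 * n) → ℂ :=
  fun k => z ((othersOf i j).orderEmbOfFin (card_othersOf h) k)

/-- The cube root of unity `e^{2πi/3}`. -/
def cubeRoot : ℂ := Complex.exp (2 * Real.pi * Complex.I / 3)

end

/-! Let Δ be the Vandermonde determinant and A the alternant with exponents 0, 1, 3, 4, 6, 7, …. The
core is the identity Z_n Δ = A, proved by induction on n through interpolation in the first row
parameter (`partitionPolynomial_mul_powDet_succ`). At size n + 1 both sides have degree at most 3n +
1 in it. Both vanish when it equals one of the other 2n + 1 parameters, and they agree when it
equals q² times one of the n + 1 column parameters: 3n + 2 points in all.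

The agreement compares two recursions. In the model, w = qz kills one of the two weights possible at
the top left corner, which freezes the first row and column (`reducedPartition_cons_cons`); the
Yang–Baxter equation makes column transfer matrices commute, so any column can take the first place
(`reducedPartition_comp_perm`). In A, the exponents grow by 3 every two columns, so a pair x, y with
y³ = x³ splits off (`powDet_stair_cons_cons`).

Only symmetry in the column parameters enters. Symmetry in all variables, the exact degree and the
general recursion follow from the determinant identity. -/

/-- The weights of the six-vertex model at a cube root of unity `q` after a change of gauge that
makes them polynomial in the spectral parameters `z` (row) and `w` (column). -/
def reducedWeight {R : Type*} [CommRing R] (q z w : R) (l r t d : Bool) : R :=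
  match l, r, t, d with
  | true, true, true, true => w - q * z
  | false, false, false, false => w - q * z
  | true, true, false, false => z - q * w
  | false, false, true, true => z - q * w
  | true, false, true, false => 1
  | false, true, false, true => (1 - q) ^ 2 * z * w
  | _, _, _, _ => 0

theorem map_reducedWeight {R S : Type*} [CommRing R] [CommRing S] (f : R →+* S) (q z w : R)
    (l r t d : Bool) :
    f (reducedWeight q z w l r t d) = reducedWeight (f q) (f z) (f w) l r t d := by
  cases l <;> cases r <;> cases t <;> cases d <;> simp [reducedWeight]

/-! ### Matrix products as sums over paths -/

section PathSum

variable {R S : Type*} [CommRing R] [Fintype S]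

theorem Fin.sum_pi_succ (k : ℕ) (f : (Fin (k + 1) → S) → R) :
    ∑ h, f h = ∑ s : S, ∑ h : Fin k → S, f (Fin.cons s h) := by
  rw [← Fintype.sum_prod_type']
  exact (Fintype.sum_equiv (Fin.consEquiv fun _ => S) _ _ fun _ => rfl).symm

theorem Matrix.list_prod_ofFn_apply [DecidableEq S] (k : ℕ) (M : Fin k → Matrix S S R) (a b : S) :
    (List.ofFn M).prod a b = ∑ h : Fin (k + 1) → S,
      if h 0 = a ∧ h (Fin.last k) = b then ∏ j, M j (h j.castSucc) (h j.succ) else 0 := by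
  induction k generalizing a with
  | zero =>
    rw [Fin.sum_pi_succ]
    simp [Matrix.one_apply, ite_and]
  | succ k ih =>
    rw [List.ofFn_succ, List.prod_cons, Matrix.mul_apply, Fin.sum_pi_succ]
    simp only [ih, Fin.cons_zero, ← Fin.succ_last, Fin.cons_succ, Fin.prod_univ_succ,
      Fin.castSucc_zero, ← Fin.succ_castSucc, ite_and, Finset.mul_sum]
    rw [Finset.sum_comm]
    conv_rhs => rw [Finset.sum_comm]
    refine Finset.sum_congr rfl fun h _ => ?_
    simp [mul_ite]

end PathSum

/-! ### Yang–Baxter equation and commuting column transfer matrices -/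

section Transfer

open Matrix Kronecker

variable {R : Type*} [CommRing R]

/-- The monodromy matrix of a column with parameter `w`, between the top and the bottom edge;
the arrows to the left and to the right of the column are `l` and `r`. -/
def columnMonodromy {n : ℕ} (q : R) (z : Fin n → R) (w : R) (l r : Fin n → Bool) :
    Matrix Bool Bool R :=
  (List.ofFn fun i => Matrix.of fun t d => reducedWeight q (z i) w (l i) (r i) t d).prod

/-- The transfer matrix of a column whose top arrow points up and whose bottom arrow points
down. -/
def columnTransfer {n : ℕ} (q : R) (z : Fin n → R) (w : R) :
    Matrix (Fin n → Bool) (Fin n → Bool) R :=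
  Matrix.of fun l r => columnMonodromy q z w l r true false

theorem columnMonodromy_succ {n : ℕ} (q : R) (z : Fin (n + 1) → R) (w : R)
    (l r : Fin (n + 1) → Bool) :
    columnMonodromy q z w l r =
      (Matrix.of fun t d => reducedWeight q (z 0) w (l 0) (r 0) t d) *
        columnMonodromy q (Fin.tail z) w (Fin.tail l) (Fin.tail r) := by
  simp [columnMonodromy, List.ofFn_succ, Fin.tail]

/-- The monodromy matrix of two adjacent columns. -/
def pairMonodromy {n : ℕ} (q : R) (z : Fin n → R) (w w' : R) (l r : Fin n → Bool) :
    Matrix (Bool × Bool) (Bool × Bool) R :=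
  ∑ m, columnMonodromy q z w l m ⊗ₖ columnMonodromy q z w' m r

/-- The contribution of a single row to the monodromy matrix of two adjacent columns. -/
def pairWeight (q z w w' : R) (l r : Bool) : Matrix (Bool × Bool) (Bool × Bool) R :=
  ∑ m, (Matrix.of fun t d => reducedWeight q z w l m t d) ⊗ₖ
    (Matrix.of fun t d => reducedWeight q z w' m r t d)

theorem pairMonodromy_succ {n : ℕ} (q : R) (z : Fin (n + 1) → R) (w w' : R)
    (l r : Fin (n + 1) → Bool) :
    pairMonodromy q z w w' l r = pairWeight q (z 0) w w' (l 0) (r 0) *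
        pairMonodromy q (Fin.tail z) w w' (Fin.tail l) (Fin.tail r) := by
  rw [pairMonodromy, pairMonodromy, pairWeight, Finset.sum_mul_sum, ← Fintype.sum_prod_type',
    ← (Fin.consEquiv fun _ : Fin (n + 1) => Bool).sum_comp]
  refine Finset.sum_congr rfl fun m _ => ?_
  simp [columnMonodromy_succ, Matrix.mul_kronecker_mul, Fin.consEquiv]

/-- The weights of the crossing of two columns with parameters `w` and `w'`. -/
def crossingWeight (q w w' : R) (s s' t t' : Bool) : R :=
  match s, s', t, t' with
  | true, true, true, true => w' - q ^ 2 * w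
  | false, false, false, false => w' - q ^ 2 * w
  | true, false, false, true => q * (w - w')
  | false, true, true, false => q * (w - w')
  | true, false, true, false => (1 - q ^ 2) * w
  | false, true, false, true => (1 - q ^ 2) * w'
  | _, _, _, _ => 0

/-- The `R`-matrix that intertwines two columns. -/
def columnRMatrix (q w w' : R) : Matrix (Bool × Bool) (Bool × Bool) R :=
  Matrix.of fun s t => crossingWeight q w w' s.1 s.2 t.1 t.2

/-- The Yang–Baxter equation. -/
theorem columnRMatrix_mul_pairWeight {q : R} (hq : q ^ 2 + q + 1 = 0) (z w w' : R) (l r : Bool) :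
    columnRMatrix q w w' * pairWeight q z w w' l r =
      pairWeight q z w' w l r * columnRMatrix q w w' := by
  have h2 : q ^ 2 = -q - 1 := by linear_combination hq
  have h3 : q ^ 3 = 1 := by linear_combination (q - 1) * hq
  ext ⟨s, s'⟩ ⟨t, t'⟩
  simp only [Matrix.mul_apply, Fintype.sum_prod_type, Fintype.sum_bool, columnRMatrix,
      pairWeight, Matrix.add_apply, Matrix.kroneckerMap_apply, Matrix.of_apply]
  cases l <;> cases r <;> cases s <;> cases s' <;> cases t <;> cases t' <;>
    simp only [crossingWeight, reducedWeight, mul_zero, zero_mul, add_zero, zero_add, mul_one,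
      one_mul] <;>
    grind

/-- The one-row Yang–Baxter equation carries the crossing of the two columns through the rows one at
a time. -/
theorem columnRMatrix_mul_pairMonodromy {n : ℕ} {q : R} (hq : q ^ 2 + q + 1 = 0) (z : Fin n → R)
    (w w' : R) (l r : Fin n → Bool) :
    columnRMatrix q w w' * pairMonodromy q z w w' l r =
      pairMonodromy q z w' w l r * columnRMatrix q w w' := by
  induction n with
  | zero => simp [pairMonodromy, columnMonodromy]
  | succ n ih =>
    rw [pairMonodromy_succ, ← Matrix.mul_assoc, columnRMatrix_mul_pairWeight hq, Matrix.mul_assoc,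
      ih, ← Matrix.mul_assoc, ← pairMonodromy_succ]

theorem columnTransfer_mul_apply {n : ℕ} (q : R) (z : Fin n → R) (w w' : R) (l r : Fin n → Bool) :
    (columnTransfer q z w * columnTransfer q z w') l r =
      pairMonodromy q z w w' l r (true, true) (false, false) := by
  simp [Matrix.mul_apply, columnTransfer, pairMonodromy, Matrix.sum_apply]

/-- The crossing acts on the states (up, up) and (down, down) by the same scalar `w' - q ^ 2 * w`,
so this entry of the intertwining relation compares the two orders of the columns. -/
theorem mul_columnTransfer_mul {n : ℕ} {q : R} (hq : q ^ 2 + q + 1 = 0)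
    (z : Fin n → R) (w w' : R) (l r : Fin n → Bool) :
    (w' - q ^ 2 * w) * (columnTransfer q z w * columnTransfer q z w') l r =
      (w' - q ^ 2 * w) * (columnTransfer q z w' * columnTransfer q z w) l r := by
  have h := congrFun (congrFun (columnRMatrix_mul_pairMonodromy hq z w w' l r) (true, true))
    (false, false)
  rw [Matrix.mul_apply, Matrix.mul_apply] at h
  simp only [Fintype.sum_prod_type, Fintype.sum_bool, columnRMatrix, Matrix.of_apply,
    crossingWeight, mul_zero, zero_mul, add_zero, zero_add] at h
  rw [columnTransfer_mul_apply, columnTransfer_mul_apply, h, mul_comm]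

theorem columnTransfer_commute [IsDomain R] {n : ℕ} {q : R} (hq : q ^ 2 + q + 1 = 0)
    (z : Fin n → R) (w w' : R) : Commute (columnTransfer q z w) (columnTransfer q z w') := by
  -- If the scalar vanishes, the relation with `w` and `w'` exchanged serves instead; both scalars
  -- vanish only if `w' = w`.
  by_cases h : w' - q ^ 2 * w = 0
  · by_cases h' : w - q ^ 2 * w' = 0
    · have : w' = w := by grind
      rw [this]
    · ext l r
      exact (mul_left_cancel₀ h' (mul_columnTransfer_mul hq z w' w l r)).symm
  · ext l r
    exact mul_left_cancel₀ h (mul_columnTransfer_mul hq z w w' l r)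

end Transfer

/-! ### The partition function as a matrix element -/

section PartitionFunction

variable {R : Type*} [CommRing R]

/-- The partition function of the rectangular grid with the gauge transformed weights, as a
matrix element of a product of column transfer matrices. -/
def reducedPartition {n k : ℕ} (q : R) (z : Fin n → R) (w : Fin k → R) : R :=
  (List.ofFn fun j => columnTransfer q z (w j)).prod (fun _ => true) (fun _ => false)

/-- The boundary condition of the domain wall configurations. -/
def ArrowConfig.IsDomainWall {n : ℕ} (C : ArrowConfig n) : Prop :=
  (∀ i, C.1 i 0 = true) ∧ (∀ i, C.1 i (Fin.last n) = false) ∧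
    (∀ j, C.2 0 j = true) ∧ (∀ j, C.2 (Fin.last n) j = false)

open Classical in
-- Only the boundary condition is imposed: a vertex that violates the ice rule has weight zero.
theorem reducedPartition_eq_sum {n : ℕ} (q : R) (z w : Fin n → R) :
    reducedPartition q z w = ∑ C : ArrowConfig n with C.IsDomainWall, ∏ i : Fin n, ∏ j : Fin n,
      reducedWeight q (z i) (w j) (C.left i j) (C.right i j) (C.above i j) (C.below i j) := by
  rw [reducedPartition, Matrix.list_prod_ofFn_apply, Finset.sum_filter, Fintype.sum_prod_type,
    ← (Equiv.piComm fun (_ : Fin n) (_ : Fin (n + 1)) => Bool).sum_comp]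
  refine Finset.sum_congr rfl fun h _ => ?_
  simp only [columnTransfer, columnMonodromy, Matrix.of_apply, Matrix.list_prod_ofFn_apply,
    Finset.prod_univ_sum, Fintype.piFinset_univ, Finset.prod_ite_zero, Finset.mem_univ,
    true_implies]
  have hite : ∀ (c : Prop) [Decidable c] (f : (Fin n → Fin (n + 1) → Bool) → R),
      (if c then ∑ v, f v else 0) = ∑ v, if c then f v else 0 := by
    intro c _ f
    split_ifs <;> simp
  rw [hite]
  conv_rhs => rw [← (Equiv.piComm fun (_ : Fin n) (_ : Fin (n + 1)) => Bool).sum_comp]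
  refine Finset.sum_congr rfl fun v _ => ?_
  rw [← ite_and]
  exact if_congr (by simp [ArrowConfig.IsDomainWall, funext_iff, forall_and, and_assoc])
    Finset.prod_comm rfl

theorem map_reducedPartition {S : Type*} [CommRing S] (f : R →+* S) {n : ℕ} (q : R)
    (z w : Fin n → R) :
    f (reducedPartition q z w) = reducedPartition (f q) (f ∘ z) (f ∘ w) := by
  classical
  simp [reducedPartition_eq_sum, map_sum, map_prod, map_reducedWeight]

theorem Fin.prod_castSucc_mul_last {n : ℕ} (f : Fin (n + 1) → R) :
    (∏ j : Fin n, f j.castSucc) * f (Fin.last n) = f 0 * ∏ j : Fin n, f j.succ := by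
  rw [← Fin.prod_univ_castSucc, Fin.prod_univ_succ]

end PartitionFunction

/-! ### The cube root of unity and the change of gauge -/

theorem cubeRoot_isPrimitiveRoot : IsPrimitiveRoot cubeRoot 3 :=
  Complex.isPrimitiveRoot_exp 3 (by norm_num)

theorem cubeRoot_ne_zero : cubeRoot ≠ 0 := cubeRoot_isPrimitiveRoot.ne_zero (by norm_num)

theorem cubeRoot_sq_add : cubeRoot ^ 2 + cubeRoot + 1 = 0 := by
  have h := cubeRoot_isPrimitiveRoot.geom_sum_eq_zero (by norm_num)
  simp only [Finset.sum_range_succ, Finset.sum_range_zero] at h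
  linear_combination h

theorem inv_sub_self_ne_zero_of_sq_eq {p : ℂ} (hp : p ^ 2 = cubeRoot) :
    (p ^ 2)⁻¹ - p ^ 2 ≠ 0 := by
  rw [hp]
  intro h
  have h0 := cubeRoot_ne_zero
  field_simp at h
  exact cubeRoot_isPrimitiveRoot.pow_ne_one_of_pos_of_lt (l := 2) (by norm_num) (by norm_num)
    (by linear_combination -h)

/-- The factor that an edge with arrow `b` contributes to a change of gauge. -/
def gaugeFactor (u : ℂ) (b : Bool) : ℂ := if b then u else 1

theorem gaugeFactor_true (u : ℂ) : gaugeFactor u true = u := rfl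

theorem gaugeFactor_false (u : ℂ) : gaugeFactor u false = 1 := rfl

theorem gaugeFactor_ne_zero {u : ℂ} (hu : u ≠ 0) (b : Bool) : gaugeFactor u b ≠ 0 := by
  cases b <;> simp [gaugeFactor, hu]

/-- The factor `p` clears the half powers of q from a and b. The gauge factors move the whole
product of the two kinds of c vertex onto one kind; there q³ = 1 gives (1 - q)² z w. -/
theorem vertexWeight_mul_gauge {p : ℂ} (hp : p ^ 2 = cubeRoot) (x y : ℂ) (l r t d : Bool) :
    vertexWeight p x y l r t d * p * gaugeFactor (((p ^ 2)⁻¹ - p ^ 2) * p * x) r *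
        gaugeFactor y d =
      reducedWeight cubeRoot (x ^ 2) (y ^ 2) l r t d *
        gaugeFactor (((p ^ 2)⁻¹ - p ^ 2) * p * x) l * gaugeFactor y t := by
  have h0 := cubeRoot_ne_zero
  have hp0 : p ≠ 0 := by
    rintro rfl
    simp [← hp] at h0
  have key := cubeRoot_sq_add
  rw [← hp] at key ⊢
  have hp6 : p ^ 6 = 1 := by linear_combination (p ^ 2 - 1) * key
  have h1 : p⁻¹ = p ^ 5 := inv_eq_of_mul_eq_one_right (by linear_combination hp6)
  have h2 : (p ^ 2)⁻¹ = p ^ 4 := by rw [← inv_pow, h1]; linear_combination p ^ 4 * hp6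
  cases l <;> cases r <;> cases t <;> cases d <;>
    simp only [vertexWeight, reducedWeight, gaugeFactor_true, gaugeFactor_false, zero_mul, h1,
      h2] <;> grind

theorem vertexWeight_eq_zero_of_inDegree_ne {n : ℕ} (C : ArrowConfig n) (i j : Fin n)
    (h : C.inDegree i j ≠ 2) (p x y : ℂ) :
    vertexWeight p x y (C.left i j) (C.right i j) (C.above i j) (C.below i j) = 0 := by
  revert h
  unfold ArrowConfig.inDegree
  cases C.left i j <;> cases C.right i j <;> cases C.above i j <;> cases C.below i j <;>
    simp [vertexWeight]

theorem prod_gaugeFactor_horizontal {n : ℕ} {C : ArrowConfig n} (hC : C.IsDomainWall)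
    (u : Fin n → ℂ) :
    ∏ i, ∏ j, gaugeFactor (u i) (C.left i j) =
      (∏ i, u i) * ∏ i, ∏ j, gaugeFactor (u i) (C.right i j) := by
  rw [← Finset.prod_mul_distrib]
  refine Finset.prod_congr rfl fun i _ => ?_
  have h := Fin.prod_castSucc_mul_last fun j => gaugeFactor (u i) (C.1 i j)
  simpa [hC.1, hC.2.1, gaugeFactor_true, gaugeFactor_false, ArrowConfig.left,
    ArrowConfig.right] using h

theorem prod_gaugeFactor_vertical {n : ℕ} {C : ArrowConfig n} (hC : C.IsDomainWall)
    (u : Fin n → ℂ) :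
    ∏ i, ∏ j, gaugeFactor (u j) (C.above i j) =
      (∏ j, u j) * ∏ i, ∏ j, gaugeFactor (u j) (C.below i j) := by
  rw [Finset.prod_comm, Finset.prod_comm (f := fun i j => gaugeFactor (u j) (C.below i j)),
    ← Finset.prod_mul_distrib]
  refine Finset.prod_congr rfl fun j _ => ?_
  have h := Fin.prod_castSucc_mul_last fun i => gaugeFactor (u j) (C.2 i j)
  simpa [hC.2.2.1, hC.2.2.2, gaugeFactor_true, gaugeFactor_false,
    ArrowConfig.above, ArrowConfig.below] using h

theorem Fin.prod_univ_rowIndex_mul_colIndex {M : Type*} [CommMonoid M] {n : ℕ}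
    (f : Fin (2 * n) → M) :
    ∏ k, f k = (∏ i : Fin n, f (rowIndex i)) * ∏ j : Fin n, f (colIndex j) := by
  rw [← (finCongr (two_mul n).symm).prod_comp, Fin.prod_univ_add]
  rfl

theorem partitionFunction_mul_pow {n : ℕ} {p : ℂ} (hp : p ^ 2 = cubeRoot) {x : Fin (2 * n) → ℂ}
    (hx : ∀ k, x k ≠ 0) :
    partitionFunction n p x * p ^ (n * n) =
      reducedPartition cubeRoot (fun i => x (rowIndex i) ^ 2) (fun j => x (colIndex j) ^ 2) *
        ((((p ^ 2)⁻¹ - p ^ 2) * p) ^ n * ∏ k, x k) := by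
  classical
  have hp0 : p ≠ 0 := by
    rintro rfl
    exact cubeRoot_ne_zero (by simp [← hp])
  have hs := mul_ne_zero (inv_sub_self_ne_zero_of_sq_eq hp) hp0
  rw [reducedPartition_eq_sum, partitionFunction, Finset.sum_mul, Finset.sum_mul]
  -- The sum may be enlarged to all domain wall arrow configurations, since those that break the ice
  -- rule contribute zero.
  have hsub : (Finset.univ.filter fun C : ArrowConfig n => C.IsDWBC) ⊆
      Finset.univ.filter fun C : ArrowConfig n => C.IsDomainWall := by
    intro C hC
    simp only [Finset.mem_filter_univ] at hC ⊢
    exact hC.2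
  rw [Finset.sum_subset hsub]
  · refine Finset.sum_congr rfl fun C hC => ?_
    rw [Finset.mem_filter_univ] at hC
    set u : Fin n → ℂ := fun i => ((p ^ 2)⁻¹ - p ^ 2) * p * x (rowIndex i) with hu
    set v : Fin n → ℂ := fun j => x (colIndex j) with hv
    have h1 := prod_gaugeFactor_horizontal hC u
    have h2 := prod_gaugeFactor_vertical hC v
    have h3 : (∏ i, ∏ j, gaugeFactor (u i) (C.right i j)) ≠ 0 :=
      Finset.prod_ne_zero_iff.2 fun i _ => Finset.prod_ne_zero_iff.2 fun j _ =>
        gaugeFactor_ne_zero (mul_ne_zero hs (hx _)) _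
    have h4 : (∏ i, ∏ j, gaugeFactor (v j) (C.below i j)) ≠ 0 :=
      Finset.prod_ne_zero_iff.2 fun i _ => Finset.prod_ne_zero_iff.2 fun j _ =>
        gaugeFactor_ne_zero (hx _) _
    have h5 : ∏ i : Fin n, ∏ j : Fin n, (vertexWeight p (x (rowIndex i)) (x (colIndex j))
          (C.left i j) (C.right i j) (C.above i j) (C.below i j) * p *
          gaugeFactor (u i) (C.right i j) * gaugeFactor (v j) (C.below i j)) =
        ∏ i : Fin n, ∏ j : Fin n, (reducedWeight cubeRoot (x (rowIndex i) ^ 2)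
          (x (colIndex j) ^ 2) (C.left i j) (C.right i j) (C.above i j) (C.below i j) *
          gaugeFactor (u i) (C.left i j) * gaugeFactor (v j) (C.above i j)) :=
      Finset.prod_congr rfl fun i _ => Finset.prod_congr rfl fun j _ =>
        vertexWeight_mul_gauge hp _ _ _ _ _ _
    simp only [Finset.prod_mul_distrib, h1, h2, Finset.prod_const, Finset.card_univ,
      Fintype.card_fin, ← pow_mul] at h5
    -- The gauge factors of the right and lower edges occur on both sides; only those of the left
    -- and top boundary survive.
    refine mul_right_cancel₀ (mul_ne_zero h3 h4) ?_
    rw [Fin.prod_univ_rowIndex_mul_colIndex]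
    have h6 : ∏ i, u i = (((p ^ 2)⁻¹ - p ^ 2) * p) ^ n * ∏ i : Fin n, x (rowIndex i) := by
      simp [hu, Finset.prod_mul_distrib, mul_pow]
    rw [h6] at h5
    linear_combination h5
  · intro C hC hC'
    rw [Finset.mem_filter_univ] at hC hC'
    have : ∃ i j, C.inDegree i j ≠ 2 := by
      by_contra! h
      exact hC' ⟨h, hC⟩
    obtain ⟨i, j, hij⟩ := this
    rw [Finset.prod_eq_zero (Finset.mem_univ i), zero_mul]
    exact Finset.prod_eq_zero (Finset.mem_univ j) (vertexWeight_eq_zero_of_inDegree_ne C i j hij _ _ _)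

theorem normalizedPartitionFunction_eq {n : ℕ} {p : ℂ} (hp : p ^ 2 = cubeRoot)
    {x : Fin (2 * n) → ℂ} (hx : ∀ k, x k ≠ 0) :
    normalizedPartitionFunction n p x = ((-cubeRoot) ^ (n * (n - 1) / 2))⁻¹ *
      reducedPartition cubeRoot (fun i => x (rowIndex i) ^ 2) (fun j => x (colIndex j) ^ 2) := by
  have hp0 : p ≠ 0 := by
    rintro rfl
    exact cubeRoot_ne_zero (by simp [← hp])
  have hs := inv_sub_self_ne_zero_of_sq_eq hp
  have hX : ∏ k, x k ≠ 0 := Finset.prod_ne_zero_iff.2 fun k _ => hx k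
  have h := partitionFunction_mul_pow hp hx
  -- Of the n² factors `p`, one per vertex, n cancel against the gauge factors of the left boundary;
  -- the remaining n(n - 1) form a power of q.
  have hn : p ^ (n * n) = p ^ n * cubeRoot ^ (n * (n - 1) / 2) := by
    rw [← hp, ← pow_mul, ← pow_add, Nat.mul_div_cancel' (Nat.even_mul_pred_self n).two_dvd]
    congr 1
    cases n <;> simp; ring
  rw [hn, mul_pow] at h
  rw [normalizedPartitionFunction, neg_pow cubeRoot]
  have h1 : (-1 : ℂ) ^ (n * (n - 1) / 2) ≠ 0 := pow_ne_zero _ (by norm_num)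
  have h2 := pow_ne_zero (n * (n - 1) / 2) cubeRoot_ne_zero
  generalize (p ^ 2)⁻¹ - p ^ 2 = s at hs h ⊢
  field_simp
  refine mul_left_cancel₀ (pow_ne_zero n hp0) ?_
  linear_combination h

/-! ### Column symmetry and the frozen corner -/

section Recursion

variable {R : Type*} [CommRing R]

theorem reducedPartition_comp_perm [IsDomain R] {n k : ℕ} {q : R} (hq : q ^ 2 + q + 1 = 0)
    (z : Fin n → R) (w : Fin k → R) (σ : Equiv.Perm (Fin k)) :
    reducedPartition q z (w ∘ σ) = reducedPartition q z w := by
  unfold reducedPartition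
  refine congrFun (congrFun ?_ _) _
  refine (σ.ofFn_comp_perm fun j => columnTransfer q z (w j)).prod_eq' ?_
  refine List.pairwise_of_forall_mem_list fun a ha b hb => ?_
  obtain ⟨i, rfl⟩ := List.mem_ofFn.1 ha
  obtain ⟨j, rfl⟩ := List.mem_ofFn.1 hb
  exact columnTransfer_commute hq z _ _

/-- A vertex entered by a right arrow from the left and a down arrow from above can only continue
both lines, so the column is frozen. -/
theorem columnMonodromy_true_false {n : ℕ} (q : R) (z : Fin n → R) (w : R) (r : Fin n → Bool) :
    columnMonodromy q z w (fun _ => true) r false false =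
      if r = fun _ => true then ∏ i, (z i - q * w) else 0 := by
  induction n with
  | zero => simp [columnMonodromy, Subsingleton.elim r (fun _ => true)]
  | succ n ih =>
    obtain ⟨r₀, r, rfl⟩ : ∃ r₀ r', r = Fin.cons r₀ r' := ⟨_, _, (Fin.cons_self_tail r).symm⟩
    rw [columnMonodromy_succ, Matrix.mul_apply, Fintype.sum_bool]
    have ht : (fun _ : Fin (n + 1) => true) = Fin.cons true fun _ => true := by
      ext i; cases i using Fin.cases <;> rfl
    rw [ht]
    cases r₀ <;> simp [reducedWeight, ih, Fin.prod_univ_succ, Fin.tail, Fin.cons_inj]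

/-- At `w = q * z₀` the weight `w - q * z₀` of the corner vertex vanishes. The corner must be a
turn, and below it the column is frozen. -/
theorem columnTransfer_cons_true {n : ℕ} (q z₀ : R) (z : Fin n → R) (r : Fin (n + 1) → Bool) :
    columnTransfer q (Fin.cons z₀ z : Fin (n + 1) → R) (q * z₀) (fun _ => true) r =
      if r = Fin.cons false fun _ => true then ∏ i, (z i - q * (q * z₀)) else 0 := by
  obtain ⟨r₀, r, rfl⟩ : ∃ r₀ r', r = Fin.cons r₀ r' := ⟨_, _, (Fin.cons_self_tail r).symm⟩
  rw [columnTransfer, Matrix.of_apply, columnMonodromy_succ, Matrix.mul_apply, Fintype.sum_bool]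
  have ht : Fin.tail (fun _ : Fin (n + 1) => true) = fun _ => true := rfl
  cases r₀ <;> simp [reducedWeight, ht, columnMonodromy_true_false, Fin.cons_inj]

/-- A left arrow meeting an up arrow from the top boundary must go straight, so the first row stays
frozen and the up arrow is handed to the next row. -/
theorem columnTransfer_cons_false {n : ℕ} (q z₀ : R) (z : Fin n → R) (w : R) (l r : Fin n → Bool)
    (r₀ : Bool) :
    columnTransfer q (Fin.cons z₀ z : Fin (n + 1) → R) w (Fin.cons false l) (Fin.cons r₀ r) =
      if r₀ = false then (z₀ - q * w) * columnTransfer q z w l r else 0 := by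
  rw [columnTransfer, Matrix.of_apply, columnMonodromy_succ, Matrix.mul_apply, Fintype.sum_bool]
  cases r₀ <;> simp [reducedWeight, columnTransfer]

theorem prod_columnTransfer_cons_false {n k : ℕ} (q z₀ : R) (z : Fin n → R) (w : Fin k → R)
    (l r : Fin n → Bool) :
    (List.ofFn fun j => columnTransfer q (Fin.cons z₀ z : Fin (n + 1) → R) (w j)).prod
        (Fin.cons false l) (Fin.cons false r) =
      (∏ j, (z₀ - q * w j)) * (List.ofFn fun j => columnTransfer q z (w j)).prod l r := by
  induction k generalizing l with
  | zero => simp [Matrix.one_apply, Fin.cons_inj]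
  | succ k ih =>
    rw [List.ofFn_succ, List.prod_cons, Matrix.mul_apply, Fin.sum_pi_succ, Fintype.sum_bool,
      List.ofFn_succ, List.prod_cons, Matrix.mul_apply, Fin.prod_univ_succ, Finset.mul_sum]
    simp only [columnTransfer_cons_false, ih, if_true, Bool.true_eq_false, if_false, zero_mul,
      Finset.sum_const_zero, zero_add]
    exact Finset.sum_congr rfl fun m _ => by ring

theorem reducedPartition_cons_cons {n k : ℕ} (q z₀ : R) (z : Fin n → R) (w : Fin k → R) :
    reducedPartition q (Fin.cons z₀ z : Fin (n + 1) → R)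
        (Fin.cons (q * z₀) w : Fin (k + 1) → R) =
      (∏ i, (z i - q * (q * z₀))) * (∏ j, (z₀ - q * w j)) * reducedPartition q z w := by
  rw [reducedPartition, List.ofFn_succ, List.prod_cons, Matrix.mul_apply]
  simp only [Fin.cons_zero, Fin.cons_succ, columnTransfer_cons_true, ite_mul, zero_mul,
    Finset.sum_ite_eq', Finset.mem_univ, if_true]
  have hf : (fun _ : Fin (n + 1) => false) = Fin.cons false fun _ => false := by
    ext i; cases i using Fin.cases <;> rfl
  rw [hf, prod_columnTransfer_cons_false, reducedPartition, mul_assoc]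

end Recursion

/-! ### Degree in the first row parameter -/

section Degree

open MvPolynomial

variable {R τ : Type*} [CommRing R]

theorem degreeOf_reducedWeight_le {a : τ} {q z w : MvPolynomial τ R} (hq : degreeOf a q = 0)
    (hw : degreeOf a w = 0) (l r t d : Bool) :
    degreeOf a (reducedWeight q z w l r t d) ≤ if l = true ∧ r = false then 0 else degreeOf a z := by
  have h1 : degreeOf a (w - q * z) ≤ degreeOf a z :=
    (degreeOf_sub_le _ _ _).trans (max_le (by simp [hw])
      ((degreeOf_mul_le _ _ _).trans (by simp [hq])))
  have h2 : degreeOf a (z - q * w) ≤ degreeOf a z :=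
    (degreeOf_sub_le _ _ _).trans (max_le le_rfl ((degreeOf_mul_le _ _ _).trans (by simp [hq, hw])))
  have h3 : degreeOf a ((1 - q) ^ 2 * z * w) ≤ degreeOf a z := by
    have h : degreeOf a (1 - q) = 0 :=
      Nat.le_zero.1 ((degreeOf_sub_le _ _ _).trans (by simp [hq, ← C_1, degreeOf_C, -map_one]))
    refine (degreeOf_mul_le _ _ _).trans ?_
    rw [hw, add_zero]
    refine (degreeOf_mul_le _ _ _).trans ?_
    have := degreeOf_pow_le a (1 - q) 2
    omega
  have h4 : degreeOf a (1 : MvPolynomial τ R) = 0 := by rw [← C_1, degreeOf_C]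
  cases l <;> cases r <;> cases t <;> cases d <;> simp [reducedWeight, h1, h2, h3, h4]

theorem Bool.exists_castSucc_succ {n : ℕ} {f : Fin (n + 1) → Bool} (h0 : f 0 = true)
    (h1 : f (Fin.last n) = false) : ∃ j : Fin n, f j.castSucc = true ∧ f j.succ = false := by
  by_contra! h
  have : ∀ j, f j = true := by
    intro j
    induction j using Fin.induction with
    | zero => exact h0
    | succ j ih => simpa using h j ih
  simp [this] at h1

/-- The first row begins with a right arrow and ends with a left one, so it has a vertex where the
arrows face each other. Its weight is 1 or 0, which saves one degree out of `n + 1`. -/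
theorem degreeOf_reducedPartition_le {n : ℕ} {a : τ} {q : MvPolynomial τ R}
    {z w : Fin (n + 1) → MvPolynomial τ R} (hq : degreeOf a q = 0) (hz : degreeOf a (z 0) ≤ 1)
    (hz' : ∀ i : Fin n, degreeOf a (z i.succ) = 0) (hw : ∀ j, degreeOf a (w j) = 0) :
    degreeOf a (reducedPartition q z w) ≤ n := by
  classical
  rw [reducedPartition_eq_sum]
  refine (degreeOf_sum_le _ _ _).trans (Finset.sup_le fun C hC => ?_)
  rw [Finset.mem_filter_univ] at hC
  rw [Fin.prod_univ_succ]
  refine (degreeOf_mul_le _ _ _).trans ?_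
  have h2 : degreeOf a (∏ i : Fin n, ∏ j, reducedWeight q (z i.succ) (w j) (C.left i.succ j)
      (C.right i.succ j) (C.above i.succ j) (C.below i.succ j)) = 0 := by
    refine Nat.le_zero.1 ((degreeOf_prod_le _ _ _).trans (Finset.sum_nonpos fun i _ => ?_))
    refine (degreeOf_prod_le _ _ _).trans (Finset.sum_nonpos fun j _ => ?_)
    refine (degreeOf_reducedWeight_le hq (hw j) _ _ _ _).trans ?_
    simp [hz']
  rw [h2, add_zero]
  obtain ⟨j₀, hl, hr⟩ := Bool.exists_castSucc_succ (hC.1 0) (hC.2.1 0)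
  refine (degreeOf_prod_le _ _ _).trans ?_
  calc _ ≤ ∑ j, if j = j₀ then 0 else 1 := by
        refine Finset.sum_le_sum fun j _ => ?_
        refine (degreeOf_reducedWeight_le hq (hw j) _ _ _ _).trans ?_
        by_cases h : j = j₀
        · subst h
          exact (if_pos ⟨hl, hr⟩).le.trans (Nat.zero_le _)
        · rw [if_neg h]
          split_ifs
          exacts [Nat.zero_le _, hz]
    _ = n := by simp [Finset.sum_ite, Finset.filter_ne']

end Degree

/-! ### Power determinants and splitting off a pair -/

section PowDet

variable {R : Type*} [CommRing R]

/-- The determinant `det (v_i ^ (e j))`, `0 ≤ i, j < N`. -/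
def powDet {N : ℕ} (e : ℕ → ℕ) (v : Fin N → R) : R :=
  (Matrix.of fun i j : Fin N => v i ^ e j).det

theorem map_powDet {S : Type*} [CommRing S] (f : R →+* S) {N : ℕ} (e : ℕ → ℕ) (v : Fin N → R) :
    f (powDet e v) = powDet e (f ∘ v) := by
  rw [powDet, powDet, RingHom.map_det]
  congr 1
  ext i j
  simp

theorem powDet_comp_perm {N : ℕ} (e : ℕ → ℕ) (v : Fin N → R) (σ : Equiv.Perm (Fin N)) :
    powDet e (v ∘ σ) = (Equiv.Perm.sign σ : ℤ) * powDet e v :=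
  Matrix.det_permute σ (Matrix.of fun i j : Fin N => v i ^ e j)

theorem powDet_eq_zero {N : ℕ} (e : ℕ → ℕ) {v : Fin N → R} {i j : Fin N} (hij : i ≠ j)
    (h : v i = v j) : powDet e v = 0 :=
  Matrix.det_zero_of_row_eq hij (by ext k; simp [h])

theorem powDet_id_cons_cons {N : ℕ} (x y : R) (v : Fin N → R) :
    powDet id (Fin.cons x (Fin.cons y v : Fin (N + 1) → R) : Fin (N + 2) → R) =
      (y - x) * (∏ k, (v k - x) * (v k - y)) * powDet id v := by
  have h : ∀ {M : ℕ} (u : Fin M → R), powDet id u = (Matrix.vandermonde u).det := fun _ => rfl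
  simp only [h, Matrix.det_vandermonde, Fin.prod_univ_succ, Fin.prod_Ioi_zero, Fin.prod_Ioi_succ,
    Fin.cons_zero, Fin.cons_succ, Finset.prod_mul_distrib]
  ring

theorem Matrix.det_one_sub_smul_shift (N : ℕ) (c : R) :
    (1 - c • Matrix.of fun a b : Fin N => if (a : ℕ) + 2 = b then (1 : R) else 0).det = 1 := by
  rw [Matrix.det_of_isUpperTriangular]
  · exact Finset.prod_eq_one fun i _ => by simp
  · intro a b (hab : b < a)
    have h : ¬ (a : ℕ) + 2 = b := by
      have : (b : ℕ) < a := hab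
      omega
    simp [h, hab.ne']

/-- Subtracting x³ times column j - 2 from column j multiplies the older entry v^e by v³ - x³.
Beyond the first two columns this annihilates the rows of `x` and `y`. -/
theorem powDet_stair_cons_cons {N : ℕ} (x y : R) (hxy : y ^ 3 = x ^ 3) (v : Fin N → R) :
    powDet (fun j => j + j / 2) (Fin.cons x (Fin.cons y v : Fin (N + 1) → R) : Fin (N + 2) → R) =
      (y - x) * (∏ k, (v k ^ 3 - x ^ 3)) * powDet (fun j => j + j / 2) v := by
  set u : Fin (N + 2) → R := Fin.cons x (Fin.cons y v : Fin (N + 1) → R) with hu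
  set M : Matrix (Fin (N + 2)) (Fin (N + 2)) R := Matrix.of fun i j => u i ^ ((j : ℕ) + j / 2)
  set S : Matrix (Fin (N + 2)) (Fin (N + 2)) R :=
    Matrix.of fun a b => if (a : ℕ) + 2 = b then (1 : R) else 0
  have hMS : ∀ i j, (M * (1 - x ^ 3 • S)) i j = M i j - x ^ 3 * (M * S) i j := by
    intro i j
    rw [mul_sub, mul_one, Matrix.mul_smul]
    rfl
  have h0 : ∀ i, (M * (1 - x ^ 3 • S)) i 0 = 1 := by
    intro i
    rw [hMS]
    simp [Matrix.mul_apply, M, S]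
  have h1 : ∀ i, (M * (1 - x ^ 3 • S)) i 1 = u i := by
    intro i
    rw [hMS]
    simp [Matrix.mul_apply, M, S]
  have h2 : ∀ i (k : Fin N), (M * (1 - x ^ 3 • S)) i k.succ.succ =
      (u i ^ 3 - x ^ 3) * u i ^ ((k : ℕ) + k / 2) := by
    intro i k
    have hk : ∀ a : Fin (N + 2), ((a : ℕ) + 2 = k.succ.succ) ↔ a = k.castSucc.castSucc := by
      intro a
      simp [Fin.ext_iff]
    simp only [hMS, Matrix.mul_apply, M, S, Matrix.of_apply, hk, mul_ite, mul_zero, Finset.sum_ite_eq',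
      Finset.mem_univ, if_true]
    have : ((k.succ.succ : Fin (N + 2)) : ℕ) + (k.succ.succ : Fin (N + 2)) / 2 =
        3 + ((k : ℕ) + k / 2) := by
      simp; omega
    rw [this, pow_add]
    simp
    ring
  have hdet : powDet (fun j => j + j / 2) u = (M * (1 - x ^ 3 • S)).det := by
    rw [Matrix.det_mul, Matrix.det_one_sub_smul_shift, mul_one]
    rfl
  let E : Fin 2 ⊕ Fin N ≃ Fin (N + 2) := finSumFinEquiv.trans (finCongr (add_comm 2 N))
  have e0 : E (Sum.inl 0) = 0 := rfl
  have e1 : E (Sum.inl 1) = 1 := by ext; simp [E]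
  have e2 : ∀ k, E (Sum.inr k) = k.succ.succ := by intro k; ext; simp [E]
  have u0 : u 0 = x := rfl
  have u1 : u 1 = y := rfl
  have u2 : ∀ k : Fin N, u k.succ.succ = v k := fun k => rfl
  rw [hdet, ← Matrix.det_submatrix_equiv_self E]
  -- The matrix is now block lower triangular, and the lower left block does not affect the
  -- determinant.
  have hblock : (M * (1 - x ^ 3 • S)).submatrix E E = Matrix.fromBlocks !![1, x; 1, y] 0
      (Matrix.of fun i j => if j = 0 then 1 else v i)
      (Matrix.of fun i j => (v i ^ 3 - x ^ 3) *
        (Matrix.of fun i j : Fin N => v i ^ ((j : ℕ) + j / 2)) i j) := by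
    ext (i | i) (j | j)
    · fin_cases i <;> fin_cases j <;> simp [e0, e1, h0, h1, u0, u1]
    · fin_cases i <;> simp [e0, e1, e2, h2, u0, u1, hxy]
    · fin_cases j <;> simp [e0, e1, e2, h0, h1, u2]
    · simp [e2, h2, u2]
  rw [hblock, Matrix.det_fromBlocks_zero₁₂, Matrix.det_fin_two_of, Matrix.det_mul_column, powDet]
  ring

end PowDet

/-! ### Coefficients and degrees of power determinants -/

section PowDetDegree

open MvPolynomial

variable {R : Type*} [CommRing R]

theorem powDet_X_eq_sum {N : ℕ} (e : ℕ → ℕ) :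
    powDet e (X : Fin N → MvPolynomial (Fin N) R) = ∑ σ : Equiv.Perm (Fin N),
      monomial (Finsupp.equivFunOnFinite.symm fun k => e (σ.symm k))
        ((Equiv.Perm.sign σ : ℤ) : R) := by
  rw [powDet, Matrix.det_apply']
  refine Finset.sum_congr rfl fun σ _ => ?_
  rw [monomial_eq, Finsupp.prod_fintype _ _ (by simp),
    ← Equiv.prod_comp σ fun k => (X k : MvPolynomial (Fin N) R) ^ _]
  simp

/-- For injective exponents, different permutations give different monomials, so nothing cancels. -/
theorem coeff_powDet_X {N : ℕ} {e : ℕ → ℕ} (he : Function.Injective e) (τ : Equiv.Perm (Fin N)) :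
    coeff (Finsupp.equivFunOnFinite.symm fun k => e (τ.symm k))
      (powDet e (X : Fin N → MvPolynomial (Fin N) R)) = ((Equiv.Perm.sign τ : ℤ) : R) := by
  classical
  rw [powDet_X_eq_sum, coeff_sum, Finset.sum_eq_single τ]
  · simp
  · intro σ _ hσ
    rw [coeff_monomial, if_neg]
    intro h
    apply hσ
    have h' := Finsupp.equivFunOnFinite.symm.injective h
    rw [← Equiv.symm_bijective.injective.eq_iff]
    ext k
    exact he (congrFun h' k)
  · simp

theorem powDet_X_coeff_ne_zero [Nontrivial R] {N : ℕ} {e : ℕ → ℕ} (he : Function.Injective e)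
    (τ : Equiv.Perm (Fin N)) :
    coeff (Finsupp.equivFunOnFinite.symm fun k => e (τ.symm k))
      (powDet e (X : Fin N → MvPolynomial (Fin N) R)) ≠ 0 := by
  rw [coeff_powDet_X he]
  rcases Int.units_eq_one_or (Equiv.Perm.sign τ) with h | h <;> simp [h]

theorem powDet_X_ne_zero [Nontrivial R] {N : ℕ} {e : ℕ → ℕ} (he : Function.Injective e) :
    powDet e (X : Fin N → MvPolynomial (Fin N) R) ≠ 0 := by
  intro h
  have := powDet_X_coeff_ne_zero (R := R) he (1 : Equiv.Perm (Fin N))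
  simp [h] at this

theorem degreeOf_powDet_X [Nontrivial R] {N : ℕ} {e : ℕ → ℕ} (he : StrictMono e)
    (k : Fin (N + 1)) :
    degreeOf k (powDet e (X : Fin (N + 1) → MvPolynomial (Fin (N + 1)) R)) = e N := by
  classical
  apply le_antisymm
  · rw [powDet_X_eq_sum]
    refine (degreeOf_sum_le _ _ _).trans (Finset.sup_le fun σ _ => ?_)
    refine (degreeOf_le_iff.2 fun m hm => ?_)
    rw [Finset.mem_singleton.1 (support_monomial_subset hm)]
    exact he.monotone (Nat.lt_succ_iff.1 (σ.symm k).is_lt)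
  -- The transposition of `k` and the last index puts the largest exponent on the variable `k`.
  · have h := monomial_le_degreeOf k (mem_support_iff.2
      (powDet_X_coeff_ne_zero (R := R) he.injective (Equiv.swap k (Fin.last N))))
    simpa using h

end PowDetDegree

/-! ### The determinant identity by interpolation -/

section PartitionPolynomial

open MvPolynomial

/-- The normalized partition function as a polynomial in the spectral parameters. -/
noncomputable def partitionPolynomial (n : ℕ) : MvPolynomial (Fin (2 * n)) ℂ :=
  C ((-cubeRoot) ^ (n * (n - 1) / 2))⁻¹ *
    reducedPartition (C cubeRoot) (fun i => X (rowIndex i)) (fun j => X (colIndex j))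

/-- The exponents `0, 1, 3, 4, 6, 7, …` of the alternant of the doubled staircase. -/
def stairExponent (j : ℕ) : ℕ := j + j / 2

theorem stairExponent_strictMono : StrictMono stairExponent :=
  strictMono_nat_of_lt_succ fun j => by unfold stairExponent; omega

variable {S : Type*} [CommRing S] [Algebra ℂ S]

theorem aeval_partitionPolynomial {n : ℕ} (z : Fin (2 * n) → S) :
    aeval z (partitionPolynomial n) = algebraMap ℂ S ((-cubeRoot) ^ (n * (n - 1) / 2))⁻¹ *
      reducedPartition (algebraMap ℂ S cubeRoot) (fun i => z (rowIndex i))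
        (fun j => z (colIndex j)) := by
  rw [partitionPolynomial, map_mul, aeval_C, ← AlgHom.coe_toRingHom, map_reducedPartition]
  simp [Function.comp_def]

theorem aeval_powDet_X {N : ℕ} (e : ℕ → ℕ) (z : Fin N → S) :
    aeval z (powDet e (X : Fin N → MvPolynomial (Fin N) ℂ)) = powDet e z := by
  rw [← AlgHom.coe_toRingHom, map_powDet]
  congr 1
  ext k
  simp

/-- The indices that remain when the first row and the column `j` are left out. -/
def remainingIndex {n : ℕ} (j : Fin (n + 1)) (k : Fin (2 * n)) : Fin (2 * (n + 1)) :=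
  Fin.append (fun i : Fin n => rowIndex i.succ) (fun i : Fin n => colIndex (j.succAbove i))
    (Fin.cast (two_mul n) k)

theorem remainingIndex_rowIndex {n : ℕ} (j : Fin (n + 1)) (i : Fin n) :
    remainingIndex j (rowIndex i) = rowIndex i.succ :=
  Fin.append_left _ _ i

theorem remainingIndex_colIndex {n : ℕ} (j : Fin (n + 1)) (i : Fin n) :
    remainingIndex j (colIndex i) = colIndex (j.succAbove i) :=
  Fin.append_right _ _ i

theorem rowIndex_injective (n : ℕ) : Function.Injective (rowIndex : Fin n → Fin (2 * n)) := by
  intro i j h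
  simpa [rowIndex, Fin.ext_iff] using h

theorem colIndex_injective (n : ℕ) : Function.Injective (colIndex : Fin n → Fin (2 * n)) := by
  intro i j h
  simpa [colIndex, Fin.ext_iff] using h

theorem rowIndex_ne_colIndex {n : ℕ} (i j : Fin n) : rowIndex i ≠ colIndex j := by
  simp only [rowIndex, colIndex, ne_eq, Fin.mk.injEq]
  omega

theorem exists_eq_rowIndex_or_colIndex {n : ℕ} (k : Fin (2 * n)) :
    (∃ i, k = rowIndex i) ∨ ∃ j, k = colIndex j := by
  by_cases h : (k : ℕ) < n
  · exact Or.inl ⟨⟨k, h⟩, rfl⟩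
  · exact Or.inr ⟨⟨k - n, by omega⟩, by ext; simp [colIndex]; omega⟩

theorem cons_remainingIndex_injective {n : ℕ} (j : Fin (n + 1)) :
    Function.Injective (Fin.cons (colIndex j) (Fin.cons (rowIndex 0) (remainingIndex j) :
      Fin (2 * n + 1) → Fin (2 * (n + 1))) : Fin (2 * n + 2) → Fin (2 * (n + 1))) := by
  rw [Fin.cons_injective_iff, Fin.cons_injective_iff, Fin.range_cons]
  refine ⟨?_, ?_, ?_⟩
  · rintro (h | ⟨k, h⟩)
    · exact rowIndex_ne_colIndex _ _ h.symm
    · obtain ⟨i, rfl⟩ | ⟨i, rfl⟩ := exists_eq_rowIndex_or_colIndex k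
      · rw [remainingIndex_rowIndex] at h
        exact rowIndex_ne_colIndex _ _ h
      · rw [remainingIndex_colIndex] at h
        exact Fin.succAbove_ne _ _ (colIndex_injective _ h)
  · rintro ⟨k, h⟩
    obtain ⟨i, rfl⟩ | ⟨i, rfl⟩ := exists_eq_rowIndex_or_colIndex k
    · rw [remainingIndex_rowIndex] at h
      exact Fin.succ_ne_zero _ (rowIndex_injective _ h)
    · rw [remainingIndex_colIndex] at h
      exact rowIndex_ne_colIndex _ _ h.symm
  · refine Function.Injective.comp ?_ (finCongr (two_mul n)).injective
    rw [Fin.append_injective_iff]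
    refine ⟨fun a b h => Fin.succ_injective _ (rowIndex_injective _ h),
      fun a b h => Fin.succAbove_right_injective (colIndex_injective _ h),
      fun a b => rowIndex_ne_colIndex _ _⟩

/-- As q³ = 1, the hypothesis says that the column parameter is q times that of the first row.
Column symmetry brings column `j` to the front, where the corner freezes. -/
theorem aeval_partitionPolynomial_succ [IsDomain S] {n : ℕ} (z : Fin (2 * (n + 1)) → S)
    (j : Fin (n + 1)) (hz : z (rowIndex 0) = algebraMap ℂ S (cubeRoot ^ 2) * z (colIndex j)) :
    aeval z (partitionPolynomial (n + 1)) =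
      (∏ k, (algebraMap ℂ S cubeRoot * z (colIndex j) - z (remainingIndex j k))) *
        aeval (z ∘ remainingIndex j) (partitionPolynomial n) := by
  set q := algebraMap ℂ S cubeRoot with hqdef
  have hq : q ^ 2 + q + 1 = 0 := by
    simpa using congrArg (algebraMap ℂ S) cubeRoot_sq_add
  have hq3 : q ^ 3 = 1 := by linear_combination (q - 1) * hq
  rw [map_pow] at hz
  have hw : q * z (rowIndex 0) = z (colIndex j) := by
    rw [hz]
    linear_combination z (colIndex j) * hq3
  have hrow : (fun i => z (rowIndex i)) = (Fin.cons (z (rowIndex 0))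
      (fun i : Fin n => z (rowIndex i.succ)) : Fin (n + 1) → S) :=
    (Fin.cons_self_tail _).symm
  have hcol : (fun i => z (colIndex i)) ∘ j.cycleRange.symm = (Fin.cons (q * z (rowIndex 0))
      (fun i : Fin n => z (colIndex (j.succAbove i))) : Fin (n + 1) → S) := by
    ext i
    cases i using Fin.cases with
    | zero => simp [hw]
    | succ i => simp
  rw [aeval_partitionPolynomial, aeval_partitionPolynomial, ← hqdef,
    ← reducedPartition_comp_perm hq _ _ j.cycleRange.symm, hcol, hrow, reducedPartition_cons_cons,
    hw, Fin.prod_univ_rowIndex_mul_colIndex]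
  simp only [remainingIndex_rowIndex, remainingIndex_colIndex, Function.comp_apply]
  have h1 : ∏ i : Fin n, (z (rowIndex i.succ) - q * z (colIndex j)) =
      (-1) ^ n * ∏ i : Fin n, (q * z (colIndex j) - z (rowIndex i.succ)) := by
    rw [← Fin.prod_const, ← Finset.prod_mul_distrib]
    exact Finset.prod_congr rfl fun i _ => by ring
  have h2 : ∏ i : Fin n, (z (rowIndex 0) - q * z (colIndex (j.succAbove i))) =
      q ^ n * ∏ i : Fin n, (q * z (colIndex j) - z (colIndex (j.succAbove i))) := by
    rw [← Fin.prod_const, ← Finset.prod_mul_distrib]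
    exact Finset.prod_congr rfl fun i _ => by rw [hz]; ring
  -- The factors (-1)^n and q^n from the frozen column and row account for the change of
  -- normalization between the two sizes.
  have h3 : algebraMap ℂ S ((-cubeRoot) ^ ((n + 1) * (n + 1 - 1) / 2))⁻¹ * (-1) ^ n * q ^ n =
      algebraMap ℂ S ((-cubeRoot) ^ (n * (n - 1) / 2))⁻¹ := by
    have h4 : (n + 1) * (n + 1 - 1) / 2 = n * (n - 1) / 2 + n := by
      cases n with
      | zero => rfl
      | succ n =>
        rw [show (n + 1 + 1) * (n + 1 + 1 - 1) = (n + 1) * (n + 1 - 1) + (n + 1) * 2 by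
          simp; ring, Nat.add_mul_div_right _ _ two_pos]
    have h5 : (-1 : S) ^ n * q ^ n = algebraMap ℂ S ((-cubeRoot) ^ n) := by
      rw [← mul_pow]; simp [hqdef]
    rw [h4, mul_assoc, h5, ← map_mul, pow_add, mul_inv, inv_mul_cancel_right₀]
    exact pow_ne_zero _ (neg_ne_zero.2 cubeRoot_ne_zero)
  rw [h1, h2, ← h3]
  ring

/-- In v³ - x³ = (v - x)(v - qx)(v - q²x) the outer factors belong to the Vandermonde determinant
and the middle one to the recursion. The number of variables v is even, so v - qx may be replaced by
qx - v. -/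
theorem powDet_stair_cons_cons_cubeRoot {n : ℕ} (x : S) (v : Fin (2 * n) → S) :
    powDet stairExponent (Fin.cons x (Fin.cons (algebraMap ℂ S (cubeRoot ^ 2) * x) v :
        Fin (2 * n + 1) → S) : Fin (2 * n + 2) → S) =
      (∏ k, (algebraMap ℂ S cubeRoot * x - v k)) *
        ((algebraMap ℂ S (cubeRoot ^ 2) * x - x) *
          ∏ k, (v k - x) * (v k - algebraMap ℂ S (cubeRoot ^ 2) * x)) *
        powDet stairExponent v := by
  rw [map_pow]
  set q := algebraMap ℂ S cubeRoot
  have hq : q ^ 2 + q + 1 = 0 := by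
    simpa using congrArg (algebraMap ℂ S) cubeRoot_sq_add
  have hq3 : q ^ 3 = 1 := by linear_combination (q - 1) * hq
  have hA := powDet_stair_cons_cons x (q ^ 2 * x)
    (by linear_combination x ^ 3 * (q ^ 3 + 1) * hq3) v
  change powDet stairExponent _ = _ * powDet stairExponent v at hA
  rw [hA]
  have h : ∏ k, (v k ^ 3 - x ^ 3) =
      (∏ k, (q * x - v k)) * ∏ k, (v k - x) * (v k - q ^ 2 * x) := by
    have h1 : ∏ k, (q * x - v k) = ∏ k, (v k - q * x) := by
      rw [← one_mul (∏ k, (v k - q * x)), ← (even_two_mul n).neg_one_pow, ← Fin.prod_const,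
        ← Finset.prod_mul_distrib]
      exact Finset.prod_congr rfl fun k _ => by ring
    rw [h1, ← Finset.prod_mul_distrib]
    refine Finset.prod_congr rfl fun k _ => ?_
    linear_combination (v k ^ 2 * x - v k * x ^ 2 * q) * hq + x ^ 3 * hq3
  rw [h]
  ring

/-- Both determinants change by the same sign when the variables are permuted, so the special pair
may be put first. -/
theorem powDet_mul_comp_eq {S : Type*} [CommRing S] {N : ℕ} {e e' : ℕ → ℕ} {z : Fin N → S} {a : S} {f : Fin N → Fin N}
    (hf : Function.Injective f) (h : a * powDet e (z ∘ f) = powDet e' (z ∘ f)) :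
    a * powDet e z = powDet e' z := by
  have h1 := powDet_comp_perm e z (Equiv.ofBijective f (Finite.injective_iff_bijective.1 hf))
  have h2 := powDet_comp_perm e' z (Equiv.ofBijective f (Finite.injective_iff_bijective.1 hf))
  rw [Equiv.coe_ofBijective] at h1 h2
  rw [h1, h2] at h
  rcases Int.units_eq_one_or
    (Equiv.Perm.sign (Equiv.ofBijective f (Finite.injective_iff_bijective.1 hf))) with h3 | h3 <;>
  · rw [h3] at h
    simpa using h

theorem MvPolynomial.algebraMap_mul_X_ne_X {τ : Type*} {c : ℂ} (hc : c ≠ 1) (k l : τ) :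
    algebraMap ℂ (MvPolynomial τ ℂ) c * X k ≠ X l := by
  intro h
  have := congrArg (eval fun _ => (1 : ℂ)) h
  simp [algebraMap_eq] at this
  exact hc this

theorem cubeRoot_sq_ne_one : cubeRoot ^ 2 ≠ 1 :=
  cubeRoot_isPrimitiveRoot.pow_ne_one_of_pos_of_lt (by norm_num) (by norm_num)

theorem MvPolynomial.eval_finSuccEquiv_eq_aeval {N : ℕ} (p : MvPolynomial (Fin (N + 1)) ℂ)
    (r : MvPolynomial (Fin N) ℂ) :
    Polynomial.eval r (finSuccEquiv ℂ N p) =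
      aeval (Fin.cons r X : Fin (N + 1) → MvPolynomial (Fin N) ℂ) p := by
  induction p using MvPolynomial.induction_on with
  | C a => simp [finSuccEquiv_apply, algebraMap_eq]
  | add p q hp hq => simp [hp, hq]
  | mul_X p k hp =>
    rw [map_mul, map_mul, Polynomial.eval_mul, hp, aeval_X]
    cases k using Fin.cases <;> simp [finSuccEquiv_X_zero, finSuccEquiv_X_succ]

theorem partitionPolynomial_mul_powDet_succ {n : ℕ}
    (ih : partitionPolynomial n * powDet id X = powDet stairExponent X) :
    partitionPolynomial (n + 1) * powDet id X = powDet stairExponent X := by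
  let T := MvPolynomial (Fin (2 * n + 1)) ℂ
  have ih' : ∀ v : Fin (2 * n) → T,
      aeval v (partitionPolynomial n) * powDet id v = powDet stairExponent v := by
    intro v
    rw [← aeval_powDet_X id v, ← map_mul, ih, aeval_powDet_X]
  let D : MvPolynomial (Fin (2 * n + 1 + 1)) ℂ :=
    partitionPolynomial (n + 1) * powDet id X - powDet stairExponent X
  have hdeg : degreeOf 0 D ≤ 3 * n + 1 := by
    refine (degreeOf_sub_le _ _ _).trans (max_le ((degreeOf_mul_le _ _ _).trans ?_) ?_)
    · have h1 : degreeOf (0 : Fin (2 * n + 1 + 1)) (partitionPolynomial (n + 1)) ≤ n := by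
        refine (degreeOf_C_mul_le _ _ _).trans (degreeOf_reducedPartition_le ?_ ?_ ?_ ?_)
        · exact degreeOf_C _ _
        · exact (degreeOf_X _ _).le.trans (by split_ifs <;> simp)
        · exact fun i => degreeOf_X_of_ne (by simp [rowIndex, Fin.ext_iff])
        · exact fun i => degreeOf_X_of_ne (Fin.ne_of_val_ne (show 0 ≠ n + 1 + (i : ℕ) by omega))
      have h2 : degreeOf (0 : Fin (2 * n + 1 + 1)) (powDet id X : MvPolynomial _ ℂ) = _ :=
        degreeOf_powDet_X strictMono_id _
      calc _ ≤ n + (2 * n + 1) := add_le_add h1 h2.le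
        _ = _ := by ring
    · rw [degreeOf_powDet_X stairExponent_strictMono]
      simp only [stairExponent]
      omega
  have hroot : ∀ r : T, aeval (Fin.cons r X : Fin (2 * n + 1 + 1) → T) (partitionPolynomial (n + 1)) *
      powDet id (Fin.cons r X : Fin (2 * n + 1 + 1) → T) =
        powDet stairExponent (Fin.cons r X : Fin (2 * n + 1 + 1) → T) →
      Polynomial.eval r (finSuccEquiv ℂ (2 * n + 1) D) = 0 := by
    intro r h
    rw [eval_finSuccEquiv_eq_aeval, map_sub, map_mul, aeval_powDet_X, aeval_powDet_X, h, sub_self]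
  have hD : finSuccEquiv ℂ (2 * n + 1) D = 0 := by
    -- The 3n + 2 interpolation points. With the first variable removed, column `j` has index `n +
    -- j` instead of `n + 1 + j`.
    let f : Fin (2 * n + 1) ⊕ Fin (n + 1) → T := Sum.elim X fun j =>
      algebraMap ℂ T (cubeRoot ^ 2) * X ⟨n + j, by omega⟩
    refine Polynomial.eq_zero_of_natDegree_lt_card_of_eval_eq_zero (f := f) _ ?_ ?_ ?_
    · refine (X_injective).sumElim ?_ fun k j => (algebraMap_mul_X_ne_X cubeRoot_sq_ne_one _ _).symm
      intro i j h
      have h' := X_injective (mul_left_cancel₀ (by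
        rw [Ne, map_eq_zero_iff _ (algebraMap ℂ T).injective]
        exact pow_ne_zero _ cubeRoot_ne_zero) h)
      simpa [Fin.ext_iff] using h'
    · rintro (k | j)
      · apply hroot
        have h : ∀ e : ℕ → ℕ, powDet e (Fin.cons (f (Sum.inl k)) X : Fin (2 * n + 1 + 1) → T) = 0 :=
          fun e => powDet_eq_zero e (Fin.succ_ne_zero k).symm (by simp [f])
        rw [h, h, mul_zero]
      · apply hroot
        set z : Fin (2 * n + 1 + 1) → T := Fin.cons (f (Sum.inr j)) X
        have hzc : z (colIndex j) = X ⟨n + j, by omega⟩ := by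
          have : (colIndex j : Fin (2 * (n + 1))) = (⟨n + j, by omega⟩ : Fin (2 * n + 1)).succ := by
            simp [colIndex, Fin.ext_iff]; ring
          rw [this]
          rfl
        have hz : z (rowIndex (0 : Fin (n + 1))) =
            algebraMap ℂ T (cubeRoot ^ 2) * z (colIndex j) := by
          rw [hzc]
          rfl
        refine powDet_mul_comp_eq (cons_remainingIndex_injective j) ?_
        have hzf : z ∘ (Fin.cons (colIndex j) (Fin.cons (rowIndex 0) (remainingIndex j) :
            Fin (2 * n + 1) → Fin (2 * (n + 1))) : Fin (2 * n + 2) → Fin (2 * (n + 1))) =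
            Fin.cons (z (colIndex j)) (Fin.cons (algebraMap ℂ T (cubeRoot ^ 2) * z (colIndex j))
              (z ∘ remainingIndex j) : Fin (2 * n + 1) → T) := by
          ext k : 1
          cases k using Fin.cases with
          | zero => rfl
          | succ k =>
            cases k using Fin.cases with
            | zero => exact hz
            | succ k => rfl
        rw [hzf, aeval_partitionPolynomial_succ z j hz]
        rw [powDet_stair_cons_cons_cubeRoot, powDet_id_cons_cons, ← ih']
        simp only [Function.comp_apply]
        ring
    · rw [natDegree_finSuccEquiv]
      simp only [Fintype.card_sum, Fintype.card_fin]
      omega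
  have := (map_eq_zero_iff _ (finSuccEquiv ℂ (2 * n + 1)).injective).1 hD
  exact sub_eq_zero.1 this

end PartitionPolynomial

/-! ### Consequences of the determinant identity -/

section MainTheorem

open MvPolynomial

theorem partitionPolynomial_mul_powDet (n : ℕ) :
    partitionPolynomial n * powDet id X = powDet stairExponent X := by
  induction n with
  | zero =>
    have : IsEmpty (Fin (2 * 0)) := Fin.isEmpty
    have h : ∀ e, powDet e (X : Fin (2 * 0) → MvPolynomial (Fin (2 * 0)) ℂ) = 1 := fun e =>
      Matrix.det_isEmpty
    rw [h, h, partitionPolynomial, reducedPartition]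
    simp [Subsingleton.elim (fun _ : Fin 0 => true) fun _ => false]
  | succ n ih => exact partitionPolynomial_mul_powDet_succ ih

theorem powDet_id_X_ne_zero (N : ℕ) : powDet id (X : Fin N → MvPolynomial (Fin N) ℂ) ≠ 0 :=
  powDet_X_ne_zero Function.injective_id

theorem partitionPolynomial_isSymmetric (n : ℕ) : (partitionPolynomial n).IsSymmetric := by
  intro σ
  have h : ∀ e, rename σ (powDet e (X : Fin (2 * n) → MvPolynomial (Fin (2 * n)) ℂ)) =
      ((Equiv.Perm.sign σ : ℤ) : MvPolynomial (Fin (2 * n)) ℂ) * powDet e X := by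
    intro e
    rw [← powDet_comp_perm, ← AlgHom.coe_toRingHom, map_powDet]
    congr 1
    ext k : 1
    simp
  have h1 := congrArg (rename σ) (partitionPolynomial_mul_powDet n)
  rw [map_mul, h, h, ← partitionPolynomial_mul_powDet n] at h1
  refine mul_right_cancel₀ (powDet_id_X_ne_zero _) ?_
  rcases Int.units_eq_one_or (Equiv.Perm.sign σ) with h3 | h3 <;>
  · rw [h3] at h1
    simpa using h1

theorem degreeOf_partitionPolynomial {n : ℕ} (k : Fin (2 * n)) :
    (partitionPolynomial n).degreeOf k = n - 1 := by
  cases n with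
  | zero => exact k.elim0
  | succ n =>
    have h := partitionPolynomial_mul_powDet (n + 1)
    have hA : powDet stairExponent (X : Fin (2 * (n + 1)) → MvPolynomial _ ℂ) ≠ 0 :=
      powDet_X_ne_zero stairExponent_strictMono.injective
    have hZ : partitionPolynomial (n + 1) ≠ 0 := by
      intro h0
      rw [h0, zero_mul] at h
      exact hA h.symm
    have h1 : degreeOf k (powDet id (X : Fin (2 * (n + 1)) → MvPolynomial _ ℂ)) = 2 * n + 1 :=
      degreeOf_powDet_X (N := 2 * n + 1) strictMono_id k
    have h2 : degreeOf k (powDet stairExponent (X : Fin (2 * (n + 1)) → MvPolynomial _ ℂ)) =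
        stairExponent (2 * n + 1) :=
      degreeOf_powDet_X (N := 2 * n + 1) stairExponent_strictMono k
    rw [← h, degreeOf_mul_eq hZ (powDet_id_X_ne_zero _), h1, stairExponent] at h2
    omega

/-- Alternants list their exponents in decreasing order, `powDet` in increasing order. The sign of
the reversal is common to numerator and denominator. -/
theorem alternant_eq_sign_mul_powDet {N : ℕ} {e : Fin N → ℕ} {e' : ℕ → ℕ}
    (h : ∀ j : Fin N, e j.rev = e' j) :
    alternant N e = ((Equiv.Perm.sign (Fin.revPerm : Equiv.Perm (Fin N)) : ℤ) :
      MvPolynomial (Fin N) ℂ) * powDet e' X := by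
  rw [powDet, ← Matrix.det_permute', alternant]
  congr 1
  ext i j : 2
  simp [← h]

theorem partitionPolynomial_mul_alternant (n : ℕ) :
    partitionPolynomial n * alternant (2 * n) (fun j => 2 * n - 1 - j) =
      alternant (2 * n) (fun j => 2 * n - 1 - j + (n - 1 - j / 2)) := by
  rw [alternant_eq_sign_mul_powDet (e' := id), alternant_eq_sign_mul_powDet (e' := stairExponent),
    ← partitionPolynomial_mul_powDet, mul_left_comm]
  · intro j
    have := j.is_lt
    simp only [Fin.val_rev, stairExponent]
    omega
  · intro j
    have := j.is_lt
    simp only [Fin.val_rev, id]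
    omega

theorem alternant_ne_zero (N : ℕ) : alternant N (fun j => N - 1 - j) ≠ 0 := by
  rw [alternant_eq_sign_mul_powDet (e' := id)]
  · refine mul_ne_zero ?_ (powDet_id_X_ne_zero _)
    rcases Int.units_eq_one_or (Equiv.Perm.sign (Fin.revPerm : Equiv.Perm (Fin N))) with h | h <;>
      simp [h]
  · intro j
    have := j.is_lt
    simp only [Fin.val_rev, id]
    omega

theorem rowLen_doubleStaircase (n j : ℕ) : (doubleStaircase n).rowLen j = n - 1 - j / 2 := by
  refine eq_of_forall_lt_iff fun k => ?_
  rw [← YoungDiagram.mem_iff_lt_rowLen, doubleStaircase, YoungDiagram.mem_ofRowLens]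
  simp only [List.length_ofFn, List.getElem_ofFn, exists_prop]
  omega

theorem algebraMap_partitionPolynomial (n : ℕ) :
    algebraMap (MvPolynomial (Fin (2 * n)) ℂ) (FractionRing (MvPolynomial (Fin (2 * n)) ℂ))
      (partitionPolynomial n) = schurFunction (2 * n) (doubleStaircase n) := by
  have h : algebraMap _ (FractionRing (MvPolynomial (Fin (2 * n)) ℂ))
      (alternant (2 * n) fun j => 2 * n - 1 - j) ≠ 0 := by
    rw [Ne, map_eq_zero_iff _ (IsFractionRing.injective _ _)]
    exact alternant_ne_zero _
  simp only [schurFunction, rowLen_doubleStaircase]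
  rw [eq_div_iff h, ← map_mul, partitionPolynomial_mul_alternant]

/-- The Vandermonde determinant can be cancelled here because the entries are distinct polynomials.
Evaluating afterwards gives the recursion also at coinciding numbers. -/
theorem aeval_partitionPolynomial_cons_cons (n : ℕ) :
    let T := MvPolynomial (Fin (2 * n + 1)) ℂ
    aeval (Fin.cons (X 0) (Fin.cons (algebraMap ℂ T (cubeRoot ^ 2) * X 0) (X ∘ Fin.succ) :
        Fin (2 * n + 1) → T) : Fin (2 * n + 2) → T) (partitionPolynomial (n + 1)) =
      (∏ k : Fin (2 * n), (algebraMap ℂ T cubeRoot * X 0 - X k.succ)) *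
        aeval (X ∘ Fin.succ : Fin (2 * n) → T) (partitionPolynomial n) := by
  intro T
  set u : Fin (2 * n + 2) → T := Fin.cons (X 0)
    (Fin.cons (algebraMap ℂ T (cubeRoot ^ 2) * X 0) (X ∘ Fin.succ) : Fin (2 * n + 1) → T) with hu
  have main : ∀ (m : ℕ) (v : Fin (2 * m) → T),
      aeval v (partitionPolynomial m) * powDet id v = powDet stairExponent v := by
    intro m v
    rw [← aeval_powDet_X id v, ← map_mul, partitionPolynomial_mul_powDet, aeval_powDet_X]
  have hvdm : ∀ (m : ℕ) (v : Fin m → T), Function.Injective v → powDet id v ≠ 0 := fun m v hv =>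
    Matrix.det_vandermonde_ne_zero_iff.2 hv
  have hv : Function.Injective (X ∘ Fin.succ : Fin (2 * n) → T) :=
    X_injective.comp (Fin.succ_injective _)
  refine mul_right_cancel₀ (hvdm (2 * n + 2) u ?_) ?_
  · rw [hu, Fin.cons_injective_iff, Fin.cons_injective_iff, Fin.range_cons]
    refine ⟨?_, ?_, hv⟩
    · rintro (h | ⟨k, h⟩)
      · exact algebraMap_mul_X_ne_X cubeRoot_sq_ne_one _ _ h.symm
      · exact Fin.succ_ne_zero k (X_injective h)
    · rintro ⟨k, h⟩
      exact algebraMap_mul_X_ne_X cubeRoot_sq_ne_one _ _ h.symm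
  · refine (main (n + 1) _).trans ?_
    rw [hu, powDet_stair_cons_cons_cubeRoot, powDet_id_cons_cons, ← main n]
    simp only [Function.comp_apply]
    ring

theorem eval_partitionPolynomial_cons_cons {n : ℕ} (x : ℂ) (v : Fin (2 * n) → ℂ) :
    eval (Fin.cons x (Fin.cons (cubeRoot ^ 2 * x) v : Fin (2 * n + 1) → ℂ) : Fin (2 * n + 2) → ℂ)
        (partitionPolynomial (n + 1)) =
      (∏ k, (cubeRoot * x - v k)) * eval v (partitionPolynomial n) := by
  have h := congrArg (aeval (Fin.cons x v : Fin (2 * n + 1) → ℂ))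
    (aeval_partitionPolynomial_cons_cons n)
  simp only [map_mul, map_prod, map_sub, aeval_X, AlgHom.commutes, Fin.cons_zero, Fin.cons_succ,
    ← AlgHom.comp_apply, comp_aeval] at h
  rw [← coe_aeval_eq_eval, ← coe_aeval_eq_eval, RingHom.coe_coe, RingHom.coe_coe]
  have h1 : (fun i => aeval (Fin.cons x v : Fin (2 * n + 1) → ℂ) ((Fin.cons (X 0)
      (Fin.cons (algebraMap ℂ (MvPolynomial (Fin (2 * n + 1)) ℂ) (cubeRoot ^ 2) * X 0)
        (X ∘ Fin.succ) : Fin (2 * n + 1) → MvPolynomial (Fin (2 * n + 1)) ℂ) :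
        Fin (2 * n + 2) → MvPolynomial (Fin (2 * n + 1)) ℂ) i)) =
      Fin.cons x (Fin.cons (cubeRoot ^ 2 * x) v : Fin (2 * n + 1) → ℂ) := by
    ext k
    cases k using Fin.cases with
    | zero => simp
    | succ k => cases k using Fin.cases <;> simp
  have h2 : (fun i => aeval (Fin.cons x v : Fin (2 * n + 1) → ℂ)
      ((X ∘ Fin.succ : Fin (2 * n) → MvPolynomial (Fin (2 * n + 1)) ℂ) i)) = v := by
    ext k
    simp
  rw [h2] at h
  exact (congrArg (fun u => aeval u (partitionPolynomial (n + 1))) h1).symm.trans h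

theorem cons_orderEmbOfFin_othersOf_injective {n : ℕ} {i j : Fin (2 * (n + 1))} (h : i ≠ j) :
    Function.Injective (Fin.cons i (Fin.cons j ((othersOf i j).orderEmbOfFin (card_othersOf h)) :
      Fin (2 * n + 1) → Fin (2 * (n + 1))) : Fin (2 * n + 2) → Fin (2 * (n + 1))) := by
  rw [Fin.cons_injective_iff, Fin.cons_injective_iff, Fin.range_cons,
    Finset.range_orderEmbOfFin]
  refine ⟨?_, ?_, RelEmbedding.injective _⟩
  · simp [othersOf, h]
  · simp [othersOf]

theorem eval_partitionPolynomial_omitTwo {n : ℕ} {i j : Fin (2 * (n + 1))} (h : i ≠ j)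
    (z : Fin (2 * (n + 1)) → ℂ) (hz : z j = cubeRoot ^ 2 * z i) :
    eval z (partitionPolynomial (n + 1)) =
      (∏ k ∈ othersOf i j, (cubeRoot * z i - z k)) *
        eval (omitTwo h z) (partitionPolynomial n) := by
  set f : Fin (2 * n + 2) → Fin (2 * (n + 1)) := Fin.cons i (Fin.cons j
    ((othersOf i j).orderEmbOfFin (card_othersOf h)) : Fin (2 * n + 1) → Fin (2 * (n + 1))) with hf
  let σ := Equiv.ofBijective f
    (Finite.injective_iff_bijective.1 (cons_orderEmbOfFin_othersOf_injective h))
  have hzf : z ∘ σ = (Fin.cons (z i) (Fin.cons (cubeRoot ^ 2 * z i) (omitTwo h z) :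
      Fin (2 * n + 1) → ℂ) : Fin (2 * n + 2) → ℂ) := by
    ext k
    cases k using Fin.cases with
    | zero => rfl
    | succ k =>
      cases k using Fin.cases with
      | zero => exact hz
      | succ k => rfl
  have hprod : ∏ k, (cubeRoot * z i - omitTwo h z k) =
      ∏ k ∈ othersOf i j, (cubeRoot * z i - z k) := by
    conv_rhs => rw [← Finset.image_orderEmbOfFin_univ (othersOf i j) (card_othersOf h)]
    rw [Finset.prod_image fun a _ b _ hab => (RelEmbedding.injective _ hab)]
    rfl
  -- Symmetry reduces an arbitrary pair `i`, `j` to the first two variables.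
  rw [← partitionPolynomial_isSymmetric (n + 1) σ, eval_rename, hzf,
    eval_partitionPolynomial_cons_cons, hprod]

end MainTheorem

theorem eval_partitionPolynomial_eq {n : ℕ} {p : ℂ} {x : Fin (2 * n) → ℂ} (hp : p ^ 2 = cubeRoot)
    (hx : ∀ k, x k ≠ 0) :
    normalizedPartitionFunction n p x =
      MvPolynomial.eval (fun k => x k ^ 2) (partitionPolynomial n) := by
  rw [normalizedPartitionFunction_eq hp hx, ← MvPolynomial.coe_aeval_eq_eval, RingHom.coe_coe,
    aeval_partitionPolynomial]
  rfl

/-- The family `Z` is determined by the first clause, which says that the normalized partition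
function at `q = e^{2πi/3}` is a polynomial in the spectral parameters `z_k = x_k ^ 2`, for every
choice of the square roots `p` of `q` and `x_k` of `z_k`. -/
theorem mainTheorem6 :
    ∃ Z : (n : ℕ) → MvPolynomial (Fin (2 * n)) ℂ,
      (∀ (n : ℕ) (p : ℂ) (x : Fin (2 * n) → ℂ), p ^ 2 = cubeRoot → (∀ k, x k ≠ 0) →
        normalizedPartitionFunction n p x = MvPolynomial.eval (fun k => x k ^ 2) (Z n)) ∧
      (∀ n : ℕ, algebraMap (MvPolynomial (Fin (2 * n)) ℂ)
          (FractionRing (MvPolynomial (Fin (2 * n)) ℂ)) (Z n) =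
        schurFunction (2 * n) (doubleStaircase n)) ∧
      (∀ n : ℕ, Z n * alternant (2 * n) (fun j => 2 * n - 1 - j) =
        alternant (2 * n) (fun j => 2 * n - 1 - j + (n - 1 - j / 2))) ∧
      (∀ n : ℕ, (Z n).IsSymmetric) ∧
      (∀ (n : ℕ) (k : Fin (2 * n)), (Z n).degreeOf k = n - 1) ∧
      (∀ (n : ℕ) (i j : Fin (2 * (n + 1))) (h : i ≠ j) (z : Fin (2 * (n + 1)) → ℂ),
        z j = cubeRoot ^ 2 * z i →
        MvPolynomial.eval z (Z (n + 1)) =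
          (∏ k ∈ othersOf i j, (cubeRoot * z i - z k)) *
            MvPolynomial.eval (omitTwo h z) (Z n)) :=
  ⟨partitionPolynomial, fun _ _ _ => eval_partitionPolynomial_eq, algebraMap_partitionPolynomial,
    partitionPolynomial_mul_alternant, partitionPolynomial_isSymmetric,
    fun _ => degreeOf_partitionPolynomial, fun _ _ _ => eval_partitionPolynomial_omitTwo⟩
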